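/- Let $q$ be a complex number with $|q|<1$. Write $(a;q)_n=\prod_{m=0}^{n-1}(1-aq^m)$, $(a;q)_\infty=\prod_{m\ge 0}(1-aq^m)$, $(q)_n=(q;q)_n$, $(q)_\infty=(q;q)_\infty$, and $(a_1,a_2,a_3;q)_\infty=(a_1;q)_\infty(a_2;q)_\infty(a_3;q)_\infty$. Let $k\ge 1$, $\ell\ge 0$ and $0\le i\le k$ be integers, and for nonnegative integers $n_1,\dots,n_k$ put $N_j=n_j+n_{j+1}+\cdots+n_k$. Then $$ \begin{aligned} &\frac{1}{(q^{i+1},q^{2k-i},q^{2k+1};q^{2k+1})_\infty}\sum_{j=-\ell}^{\ell-1}(-1)^j q^{(k+\frac12)j^2+(k-i-\frac12)j}\\ &\quad=1+\frac{(-1)^{\ell-1}q^{(k+\frac12)(\ell^2+\ell)-(i+1)\ell}\,(q)_\infty}{(q^{i+1},q^{2k-i},q^{2k+1};q^{2k+1})_\infty}\\ &\qquad\times\sum_{n_1,\dots,n_k\ge 0}\frac{(q^{2\ell+1})^{N_1+\cdots+N_k}\,q^{N_1^2+\cdots+N_k^2-N_1-\cdots-N_i}\,(1-q^\ell)}{(q)_{n_1}\cdots(q)_{n_k}\,(q)_{n_k+2\ell}\,(1-q^{\ell+n_k})},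 \end{aligned} $$ where the multisum converges absolutely, the factor $(1-q^\ell)/(1-q^{\ell+n_k})$ is read as $1$ when $\ell=n_k=0$, and the sum on the left is empty when $\ell=0$. -/

import Mathlib

namespace TruncatedTheta

noncomputable section

/-- The finite `q`-shifted factorial `(a; q)_n = (1 - a)(1 - a q) ⋯ (1 - a q ^ (n - 1))`. -/
def qPoch (a q : ℂ) (n : ℕ) : ℂ :=
  ∏ m ∈ Finset.range n, (1 - a * q ^ m)

/-- The infinite `q`-shifted factorial `(a; q)_∞ = ∏_{m ≥ 0} (1 - a q ^ m)`
(the product converges for `‖q‖ < 1`). -/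
def qPochInf (a q : ℂ) : ℂ :=
  ∏' m : ℕ, (1 - a * q ^ m)

/-- The triple product `(q ^ (i+1), q ^ (2k-i), q ^ (2k+1); q ^ (2k+1))_∞`. It is used only for
`i ≤ k`, so the natural number subtraction does not truncate. -/
def tripleProd (k i : ℕ) (q : ℂ) : ℂ :=
  qPochInf (q ^ (i + 1)) (q ^ (2 * k + 1)) *
  qPochInf (q ^ (2 * k - i)) (q ^ (2 * k + 1)) *
  qPochInf (q ^ (2 * k + 1)) (q ^ (2 * k + 1))

/-- The exponent `(k + 1/2) j ^ 2 + (k - i - 1/2) j`, written over the common denominator `2`.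
The numerator is always even (see `thetaExp_cast`), so the integer division is exact. -/
def thetaExp (k i : ℕ) (j : ℤ) : ℤ :=
  ((2 * k + 1) * j ^ 2 + (2 * k - 2 * i - 1) * j) / 2

/-- The exponent `(k + 1/2) (ℓ ^ 2 + ℓ) - (i + 1) ℓ`; here too the integer division is exact
(see `prefExp_cast`). -/
def prefExp (k i ℓ : ℕ) : ℤ :=
  ((2 * k + 1) * ((ℓ : ℤ) ^ 2 + ℓ)) / 2 - (i + 1) * ℓ

theorem thetaExp_cast (k i : ℕ) (j : ℤ) :
    (thetaExp k i j : ℚ) =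
      ((k : ℚ) + 1 / 2) * (j : ℚ) ^ 2 + ((k : ℚ) - i - 1 / 2) * j := by
  have h : (2 : ℤ) ∣ (2 * k + 1) * j ^ 2 + (2 * k - 2 * i - 1) * j := by
    obtain ⟨c, hc⟩ := (Int.even_mul_succ_self (j - 1)).two_dvd
    exact ⟨k * j ^ 2 + (k - i) * j + c, by linear_combination hc⟩
  rw [thetaExp, Int.cast_div h (by norm_num)]
  push_cast
  ring

theorem prefExp_cast (k i ℓ : ℕ) :
    (prefExp k i ℓ : ℚ) =
      ((k : ℚ) + 1 / 2) * ((ℓ : ℚ) ^ 2 + ℓ) - ((i : ℚ) + 1) * ℓ := by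
  have h : (2 : ℤ) ∣ (2 * k + 1) * ((ℓ : ℤ) ^ 2 + ℓ) := by
    obtain ⟨c, hc⟩ := (Int.even_mul_succ_self (ℓ : ℤ)).two_dvd
    exact ⟨(2 * k + 1) * c, by linear_combination (2 * (k : ℤ) + 1) * hc⟩
  rw [prefExp, Int.cast_sub, Int.cast_div h (by norm_num)]
  push_cast
  ring

/-- `N_j = n_j + n_{j+1} + ⋯ + n_k`. The summation variables `n_1, …, n_k` are indexed by
`Fin k`, the index `j : Fin k` standing for position `j + 1`. -/
def N {k : ℕ} (n : Fin k → ℕ) (j : Fin k) : ℕ :=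
  ∑ s ∈ Finset.univ.filter (fun s : Fin k => j ≤ s), n s

/-- The factor `(1 - q ^ ℓ) / (1 - q ^ (ℓ + m))`, read as `1` in the only case `ℓ = m = 0` in which
it has the form `0 / 0` (for `‖q‖ < 1`). -/
def lastRatio (q : ℂ) (ℓ m : ℕ) : ℂ :=
  if ℓ + m = 0 then 1 else (1 - q ^ ℓ) / (1 - q ^ (ℓ + m))

/-- The general term of the multisum,
`(q ^ (2ℓ+1)) ^ (N_1 + ⋯ + N_k) q ^ (N_1² + ⋯ + N_k² - N_1 - ⋯ - N_i)
  / ((q)_{n_1} ⋯ (q)_{n_k} (q)_{n_k + 2ℓ}) · (1 - q ^ ℓ) / (1 - q ^ (ℓ + n_k))`. -/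
def multisumTerm (k i ℓ : ℕ) (hk : 1 ≤ k) (q : ℂ) (n : Fin k → ℕ) : ℂ :=
  (q ^ (2 * ℓ + 1)) ^ (∑ j, N n j) *
    q ^ ((∑ j, (N n j : ℤ) ^ 2) -
      ∑ j ∈ Finset.univ.filter (fun j : Fin k => (j : ℕ) < i), (N n j : ℤ))
    / ((∏ j, qPoch q q (n j)) * qPoch q q (n ⟨k - 1, by omega⟩ + 2 * ℓ))
    * lastRatio q ℓ (n ⟨k - 1, by omega⟩)

end

end TruncatedTheta

namespace TruncatedTheta

open Finset Filter Topology

/-! By the Jacobi triple product, `tripleProd k i q` is the full bilateral theta series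
(`tsum_thetaTerm`), so the theorem evaluates the tail over j ≥ ℓ and j ≤ -ℓ-1. Factoring the j = ℓ
term out of the tail leaves a difference of two unilateral series (`tripleProd_eq_sum_add`).

The multisum produces the same difference through the Bailey chain. The factors involving only n_k
form the β-side of a Bailey pair relative to q^(2ℓ+1) (`bailey_base`), and each `bailey_step` adds
one summation variable with weight x²+(2ℓ+1)x. The terms -N_1-⋯-N_i demand weight x²+2ℓx in the
outer i variables, so the pair is first moved to base q^(2ℓ) by `bailey_change_base`. Summing over
N_1 with `tsum_bailey` gives the two series times 1/(q)_∞ (`tsum_chainTerm`). The chain step and its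
limit both rest on the q-Chu–Vandermonde sum `sum_durfee`. -/

/-! ### Reciprocal factorials and the q-Chu–Vandermonde sum. -/

/-- The reciprocal `1 / (q; q)_n`. -/
noncomputable def invPoch (q : ℂ) (n : ℕ) : ℂ := (qPoch q q n)⁻¹

theorem one_sub_pow_ne_zero {q : ℂ} (hq : ‖q‖ < 1) {n : ℕ} (hn : n ≠ 0) : 1 - q ^ n ≠ 0 := by
  intro h
  have h1 : ‖q ^ n‖ = 1 := by rw [← sub_eq_zero.mp h, norm_one]
  rw [norm_pow] at h1
  exact (pow_lt_one₀ (norm_nonneg q) hq hn).ne h1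

theorem qPoch_succ (q : ℂ) (n : ℕ) : qPoch q q (n + 1) = qPoch q q n * (1 - q ^ (n + 1)) := by
  rw [qPoch, prod_range_succ, qPoch, pow_succ' q n]

theorem qPoch_ne_zero {q : ℂ} (hq : ‖q‖ < 1) (n : ℕ) : qPoch q q n ≠ 0 := by
  induction n with
  | zero => simp [qPoch]
  | succ n ih => rw [qPoch_succ]; exact mul_ne_zero ih (one_sub_pow_ne_zero hq n.succ_ne_zero)

@[simp] theorem invPoch_zero (q : ℂ) : invPoch q 0 = 1 := by simp [invPoch, qPoch]

theorem one_sub_mul_invPoch {q : ℂ} (hq : ‖q‖ < 1) (n : ℕ) :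
    (1 - q ^ (n + 1)) * invPoch q (n + 1) = invPoch q n := by
  have := one_sub_pow_ne_zero hq n.succ_ne_zero
  have := qPoch_ne_zero hq n
  rw [invPoch, invPoch, qPoch_succ]
  field_simp

/-- The factor kills the boundary term and lowers the index of `invPoch` in all others. This and its
mirror image drive the inductions on antidiagonal sums. -/
theorem sum_antidiagonal_one_sub_fst {q : ℂ} (hq : ‖q‖ < 1) (n : ℕ) (f : ℕ → ℕ → ℂ) :
    ∑ x ∈ antidiagonal (n + 1), (1 - q ^ x.1) * (invPoch q x.1 * f x.1 x.2) =
      ∑ x ∈ antidiagonal n, invPoch q x.1 * f (x.1 + 1) x.2 := by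
  rw [Nat.sum_antidiagonal_succ]
  simp [← mul_assoc, one_sub_mul_invPoch hq]

theorem sum_antidiagonal_one_sub_snd {q : ℂ} (hq : ‖q‖ < 1) (n : ℕ) (f : ℕ → ℕ → ℂ) :
    ∑ x ∈ antidiagonal (n + 1), (1 - q ^ x.2) * (invPoch q x.2 * f x.1 x.2) =
      ∑ x ∈ antidiagonal n, invPoch q x.2 * f x.1 (x.2 + 1) := by
  rw [Nat.sum_antidiagonal_succ']
  simp [← mul_assoc, one_sub_mul_invPoch hq]

/-- A form of the `q`-Chu–Vandermonde sum (finite Durfee rectangle identity). -/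
theorem sum_durfee {q : ℂ} (hq : ‖q‖ < 1) (n s : ℕ) :
    ∑ x ∈ antidiagonal n,
        q ^ (x.1 ^ 2 + x.1 * s) * invPoch q x.1 * invPoch q (x.1 + s) * invPoch q x.2 =
      invPoch q n * invPoch q (n + s) := by
  induction n generalizing s with
  | zero => simp
  | succ n ih =>
    have h := one_sub_pow_ne_zero hq n.succ_ne_zero
    apply mul_left_cancel₀ h
    -- 1 - q^(a+b) = q^a (1 - q^b) + (1 - q^a). After lowering indices, the two pieces recombine
    -- into the sum for n with s + 1.
    have hsplit : ∀ x ∈ antidiagonal (n + 1), (1 - q ^ (n + 1)) *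
        (q ^ (x.1 ^ 2 + x.1 * s) * invPoch q x.1 * invPoch q (x.1 + s) * invPoch q x.2) =
        (1 - q ^ x.2) * (invPoch q x.2 *
          (q ^ (x.1 ^ 2 + x.1 * s + x.1) * invPoch q x.1 * invPoch q (x.1 + s))) +
        (1 - q ^ x.1) * (invPoch q x.1 *
          (q ^ (x.1 ^ 2 + x.1 * s) * invPoch q (x.1 + s) * invPoch q x.2)) := by
      intro x hx
      rw [← HasAntidiagonal.mem_antidiagonal.mp hx]
      ring
    rw [mul_sum, sum_congr rfl hsplit, sum_add_distrib,
      sum_antidiagonal_one_sub_snd hq n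
        (fun a _ => q ^ (a ^ 2 + a * s + a) * invPoch q a * invPoch q (a + s)),
      sum_antidiagonal_one_sub_fst hq n
        (fun a b => q ^ (a ^ 2 + a * s) * invPoch q (a + s) * invPoch q b), ← sum_add_distrib,
      ← mul_assoc, one_sub_mul_invPoch hq, show n + 1 + s = n + (s + 1) by ring, ← ih (s + 1)]
    refine sum_congr rfl fun x _ => ?_
    rw [show x.1 + 1 + s = x.1 + s + 1 by ring, ← one_sub_mul_invPoch hq (x.1 + s),
      ← add_assoc x.1 s 1]
    ring

/-! ### Bailey pairs: chain step, initial pair, change of base. -/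

/-- The second member of the Bailey pair relative to `q ^ t` whose first member is `α`. -/
noncomputable def bailey (q : ℂ) (t : ℕ) (α : ℕ → ℂ) (M : ℕ) : ℂ :=
  ∑ x ∈ antidiagonal M, α x.1 * invPoch q x.2 * invPoch q (x.2 + 2 * x.1 + t)

/-- One step of the Bailey chain. -/
theorem bailey_step {q : ℂ} (hq : ‖q‖ < 1) (t : ℕ) (α : ℕ → ℂ) (M : ℕ) :
    ∑ x ∈ antidiagonal M, invPoch q x.1 * (q ^ (x.2 ^ 2 + t * x.2) * bailey q t α x.2) =
      bailey q t (fun r => q ^ (r ^ 2 + t * r) * α r) M := by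
  -- Expanding by `sum_durfee` with shift 2r+t makes both sides run over r + d + e = M; the
  -- exponents agree as (r+d)²+t(r+d) = r²+tr + d²+d(2r+t).
  have hR : ∀ x ∈ antidiagonal M,
      q ^ (x.1 ^ 2 + t * x.1) * α x.1 * invPoch q x.2 * invPoch q (x.2 + 2 * x.1 + t) =
      ∑ y ∈ antidiagonal x.2, q ^ (x.1 ^ 2 + t * x.1) * α x.1 *
        (q ^ (y.1 ^ 2 + y.1 * (2 * x.1 + t)) * invPoch q y.1 * invPoch q (y.1 + (2 * x.1 + t)) *
          invPoch q y.2) := by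
    intro x _
    rw [← mul_sum, sum_durfee hq]
    ring_nf
  simp only [bailey, mul_sum]
  rw [sum_congr rfl hR, sum_sigma', sum_sigma']
  refine sum_nbij' (fun x => ⟨(x.2.1, x.2.2 + x.1.1), (x.2.2, x.1.1)⟩)
    (fun x => ⟨(x.2.2, x.1.1 + x.2.1), (x.1.1, x.2.1)⟩) ?_ ?_ ?_ ?_ ?_
  · rintro ⟨⟨e, L⟩, ⟨r, d⟩⟩ h
    simp only [mem_sigma, HasAntidiagonal.mem_antidiagonal] at h ⊢
    exact ⟨by omega, trivial⟩
  · rintro ⟨⟨r, f⟩, ⟨d, e⟩⟩ h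
    simp only [mem_sigma, HasAntidiagonal.mem_antidiagonal] at h ⊢
    exact ⟨by omega, trivial⟩
  · rintro ⟨⟨e, L⟩, ⟨r, d⟩⟩ h
    simp only [mem_sigma, HasAntidiagonal.mem_antidiagonal] at h
    obtain ⟨rfl, rfl⟩ := h
    rfl
  · rintro ⟨⟨r, f⟩, ⟨d, e⟩⟩ h
    simp only [mem_sigma, HasAntidiagonal.mem_antidiagonal] at h
    obtain ⟨rfl, rfl⟩ := h
    rfl
  · rintro ⟨⟨e, L⟩, ⟨r, d⟩⟩ h
    simp only [mem_sigma, HasAntidiagonal.mem_antidiagonal] at h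
    obtain ⟨rfl, rfl⟩ := h
    dsimp only
    rw [← add_assoc d]
    ring

/-- Induction on M for all ℓ at once: after the r = 0 term is split off, the shift r ↦ r+1 turns the
rest into -q^ℓ times the sum for (ℓ+1, M). -/
theorem bailey_base {q : ℂ} (hq : ‖q‖ < 1) (ℓ M : ℕ) :
    invPoch q M * invPoch q (M + 2 * ℓ) * lastRatio q ℓ M =
      bailey q (2 * ℓ + 1)
        (fun r => (-1) ^ r * q ^ (r.choose 2 + ℓ * r) * (1 - q ^ (2 * r + 2 * ℓ + 1))) M := by
  induction M generalizing ℓ with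
  | zero =>
    have h := one_sub_mul_invPoch hq (2 * ℓ)
    -- The convention at ℓ = m = 0 makes the base case uniform in ℓ.
    have h' : lastRatio q ℓ 0 = 1 := by
      unfold lastRatio
      split_ifs with h0
      · rfl
      · exact div_self (one_sub_pow_ne_zero hq h0)
    simp [bailey, h', h]
  | succ M ih =>
    have e : ∀ x : ℕ × ℕ, (-1 : ℂ) ^ (x.1 + 1) * q ^ ((x.1 + 1).choose 2 + ℓ * (x.1 + 1)) *
        (1 - q ^ (2 * (x.1 + 1) + 2 * ℓ + 1)) * invPoch q x.2 *
          invPoch q (x.2 + 2 * (x.1 + 1) + (2 * ℓ + 1)) =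
        -q ^ ℓ * ((-1) ^ x.1 * q ^ (x.1.choose 2 + (ℓ + 1) * x.1) *
          (1 - q ^ (2 * x.1 + 2 * (ℓ + 1) + 1)) * invPoch q x.2 *
            invPoch q (x.2 + 2 * x.1 + (2 * (ℓ + 1) + 1))) := by
      intro x
      rw [Nat.choose_succ_succ' x.1 1, Nat.choose_one_right,
        show x.2 + 2 * (x.1 + 1) + (2 * ℓ + 1) = x.2 + 2 * x.1 + (2 * (ℓ + 1) + 1) by ring,
        show 2 * (x.1 + 1) + 2 * ℓ + 1 = 2 * x.1 + 2 * (ℓ + 1) + 1 by ring]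
      ring
    rw [bailey, Nat.sum_antidiagonal_succ]
    simp only [e]
    rw [← mul_sum]
    have := ih (ℓ + 1)
    rw [bailey] at this
    rw [← this]
    have h1 := one_sub_pow_ne_zero hq (show ℓ + M + 1 ≠ 0 by omega)
    simp only [lastRatio, show ℓ + (M + 1) ≠ 0 by omega, show ℓ + 1 + M ≠ 0 by omega, if_false]
    rw [show M + 1 + 2 * ℓ = M + 2 * ℓ + 1 by ring,
      show M + 2 * (ℓ + 1) = M + 2 * ℓ + 1 + 1 by ring, show ℓ + (M + 1) = ℓ + M + 1 by ring,
      show ℓ + 1 + M = ℓ + M + 1 by ring,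
      show M + 1 + 2 * 0 + (2 * ℓ + 1) = M + 2 * ℓ + 1 + 1 by ring,
      ← one_sub_mul_invPoch hq (M + 2 * ℓ + 1), ← one_sub_mul_invPoch hq M]
    field_simp
    simp
    ring

/-- With s = M - r, write 1 - q^(2r+t+1) = (1 - q^(s+2r+t+1)) - q^(2r+t+1) (1 - q^s). The first part
lowers the base, the second lowers s and so feeds into the coefficient at r + 1. -/
theorem bailey_change_base {q : ℂ} (hq : ‖q‖ < 1) (t : ℕ) (γ : ℕ → ℂ) (M : ℕ) :
    bailey q (t + 1) (fun r => (1 - q ^ (2 * r + t + 1)) * γ r) M =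
      bailey q t (fun r => γ r - if r = 0 then 0 else q ^ (2 * r - 1 + t) * γ (r - 1)) M := by
  have hsplit : ∀ x : ℕ × ℕ, (1 - q ^ (2 * x.1 + t + 1)) * γ x.1 * invPoch q x.2 *
      invPoch q (x.2 + 2 * x.1 + (t + 1)) =
      γ x.1 * invPoch q x.2 * invPoch q (x.2 + 2 * x.1 + t) - (1 - q ^ x.2) * (invPoch q x.2 *
        (q ^ (2 * x.1 + t + 1) * γ x.1 * invPoch q (x.2 + 2 * x.1 + (t + 1)))) := by
    intro x
    rw [← add_assoc (x.2 + 2 * x.1) t 1, ← one_sub_mul_invPoch hq (x.2 + 2 * x.1 + t)]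
    ring
  rw [bailey, sum_congr rfl fun x _ => hsplit x, sum_sub_distrib]
  simp only [bailey, sub_mul _ _ (invPoch _ _), sum_sub_distrib]
  congr 1
  cases M with
  | zero => simp
  | succ M =>
    rw [sum_antidiagonal_one_sub_snd hq M (fun a b => q ^ (2 * a + t + 1) * γ a *
      invPoch q (b + 2 * a + (t + 1))), Nat.sum_antidiagonal_succ]
    simp only [if_true, zero_mul, zero_add, Nat.add_one_ne_zero, if_false]
    refine sum_congr rfl fun x _ => ?_
    rw [show x.2 + 1 + 2 * x.1 + (t + 1) = x.2 + 2 * (x.1 + 1) + t by ring,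
      show 2 * (x.1 + 1) - 1 + t = 2 * x.1 + t + 1 by omega, Nat.add_sub_cancel]
    ring

/-! ### Infinite products and the limiting Bailey lemma. -/

theorem summable_norm_mul_pow {p : ℂ} (hp : ‖p‖ < 1) (a : ℂ) :
    Summable fun m : ℕ => ‖-(a * p ^ m)‖ := by
  simp only [norm_neg, norm_mul, norm_pow]
  exact (summable_geometric_of_lt_one (norm_nonneg p) hp).mul_left _

theorem tendsto_qPoch {p : ℂ} (hp : ‖p‖ < 1) (a : ℂ) :
    Tendsto (qPoch a p) atTop (𝓝 (qPochInf a p)) := by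
  have h := (multipliable_one_add_of_summable (summable_norm_mul_pow hp a)).hasProd.tendsto_prod_nat
  simpa only [← sub_eq_add_neg] using! h

theorem qPochInf_ne_zero {a p : ℂ} (hp : ‖p‖ < 1) (ha : ‖a‖ < 1) : qPochInf a p ≠ 0 := by
  have h := tprod_one_add_ne_zero_of_summable (f := fun m : ℕ => -(a * p ^ m)) ?_
    (summable_norm_mul_pow hp a)
  · simpa only [← sub_eq_add_neg] using! h
  · intro m hm
    rw [← sub_eq_add_neg, sub_eq_zero] at hm
    have h1 : ‖a * p ^ m‖ < 1 := by
      rw [norm_mul, norm_pow]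
      exact mul_lt_one_of_nonneg_of_lt_one_left (norm_nonneg a) ha
        (pow_le_one₀ (norm_nonneg p) hp.le)
    rw [← hm, norm_one] at h1
    exact lt_irrefl _ h1

theorem tendsto_invPoch {q : ℂ} (hq : ‖q‖ < 1) :
    Tendsto (invPoch q) atTop (𝓝 (qPochInf q q)⁻¹) :=
  (tendsto_qPoch hq q).inv₀ (qPochInf_ne_zero hq hq)

theorem exists_norm_invPoch_le {q : ℂ} (hq : ‖q‖ < 1) :
    ∃ C : ℝ, 1 ≤ C ∧ ∀ n, ‖invPoch q n‖ ≤ C := by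
  obtain ⟨C, hC⟩ := (tendsto_invPoch hq).norm.bddAbove_range
  have h : ∀ n, ‖invPoch q n‖ ≤ C := fun n => hC ⟨n, rfl⟩
  exact ⟨C, by simpa using h 0, h⟩

theorem norm_pow_le_pow_of_le {q : ℂ} (hq : ‖q‖ < 1) {a b : ℕ} (h : a ≤ b) :
    ‖q ^ b‖ ≤ ‖q‖ ^ a := by
  rw [norm_pow]
  exact pow_le_pow_of_le_one (norm_nonneg q) hq.le h

/-- Let n → ∞ in `sum_durfee` by dominated convergence, then cancel one factor 1/(q)_∞. -/
theorem tsum_durfee {q : ℂ} (hq : ‖q‖ < 1) (s : ℕ) :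
    ∑' m : ℕ, q ^ (m ^ 2 + m * s) * invPoch q m * invPoch q (m + s) = (qPochInf q q)⁻¹ := by
  obtain ⟨C, hC1, hC⟩ := exists_norm_invPoch_le hq
  have hR := tendsto_invPoch hq
  set f : ℕ → ℕ → ℂ := fun n m => if m ≤ n then
    q ^ (m ^ 2 + m * s) * invPoch q m * invPoch q (m + s) * invPoch q (n - m) else 0
  have hf : ∀ n, ∑' m, f n m = invPoch q n * invPoch q (n + s) := by
    intro n
    rw [← sum_durfee hq n s, Nat.sum_antidiagonal_eq_sum_range_succ_mk,
      tsum_eq_sum (s := range (n + 1)) fun m hm => if_neg (by simpa using hm)]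
    exact sum_congr rfl fun m hm => if_pos (by simpa [Nat.lt_succ_iff] using hm)
  have hbound : ∀ n m, ‖f n m‖ ≤ ‖q‖ ^ m * C * C * C := by
    intro n m
    dsimp only [f]
    split_ifs
    · rw [norm_mul, norm_mul, norm_mul]
      gcongr
      · exact norm_pow_le_pow_of_le hq (by nlinarith [Nat.zero_le (m * s)])
      all_goals exact hC _
    · rw [norm_zero]; positivity
  have hlim := tendsto_tsum_of_dominated_convergence (𝓕 := atTop) (f := f)
    (g := fun m => q ^ (m ^ 2 + m * s) * invPoch q m * invPoch q (m + s) * (qPochInf q q)⁻¹)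
    ((((summable_geometric_of_lt_one (norm_nonneg q) hq).mul_right C).mul_right C).mul_right C)
    (fun m => by
      refine Tendsto.congr' ?_ ((hR.comp (tendsto_sub_atTop_nat m)).const_mul _)
      filter_upwards [eventually_ge_atTop m] with n hn
      exact (if_pos hn).symm)
    (Eventually.of_forall fun n m => hbound n m)
  simp only [hf] at hlim
  have h2 := tendsto_nhds_unique hlim (hR.mul (hR.comp (tendsto_add_atTop_nat s)))
  rw [tsum_mul_right] at h2
  exact mul_right_cancel₀ (inv_ne_zero (qPochInf_ne_zero hq hq)) h2

/-- The limiting form of Bailey's lemma. -/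
theorem tsum_bailey {q : ℂ} (hq : ‖q‖ < 1) (t : ℕ) {α : ℕ → ℂ} {A : ℝ} (hα : ∀ r, ‖α r‖ ≤ A) :
    ∑' M : ℕ, q ^ (M ^ 2 + t * M) * bailey q t α M =
      (qPochInf q q)⁻¹ * ∑' r : ℕ, q ^ (r ^ 2 + t * r) * α r := by
  obtain ⟨C, hC1, hC⟩ := exists_norm_invPoch_le hq
  have hA : 0 ≤ A := (norm_nonneg _).trans (hα 0)
  -- Indexed by (r, d) with M = r + d: summing along diagonals gives the left side, while for fixed
  -- r the sum over d is `tsum_durfee` with shift 2r+t.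
  set F : ℕ × ℕ → ℂ := fun x => q ^ ((x.1 + x.2) ^ 2 + t * (x.1 + x.2)) *
    (α x.1 * invPoch q x.2 * invPoch q (x.2 + 2 * x.1 + t)) with hF
  have hgeo := summable_geometric_of_lt_one (norm_nonneg q) hq
  have hs : Summable F := by
    refine Summable.of_norm_bounded
      ((((hgeo.mul_of_nonneg hgeo (fun _ => by positivity) (fun _ => by positivity)).mul_right
        (A * C * C)))) fun x => ?_
    rw [hF, norm_mul, norm_mul, norm_mul, ← pow_add]
    gcongr
    · exact norm_pow_le_pow_of_le hq (by nlinarith [Nat.zero_le (t * (x.1 + x.2))])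
    · exact hα _
    all_goals exact hC _
  have hs' : Summable fun c : Σ n : ℕ, antidiagonal n =>
      F (HasAntidiagonal.sigmaAntidiagonalEquivProd c) :=
    HasAntidiagonal.sigmaAntidiagonalEquivProd.summable_iff.mpr hs
  have h1 : ∑' x, F x = ∑' M : ℕ, q ^ (M ^ 2 + t * M) * bailey q t α M := by
    rw [← HasAntidiagonal.sigmaAntidiagonalEquivProd.tsum_eq F,
      hs'.tsum_sigma' fun n => Summable.of_finite]
    refine tsum_congr fun M => ?_
    rw [tsum_fintype, bailey, mul_sum]
    refine (sum_coe_sort (antidiagonal M) F).trans (sum_congr rfl fun x hx => ?_)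
    rw [hF]
    dsimp only
    rw [HasAntidiagonal.mem_antidiagonal.mp hx]
  rw [← h1, hs.tsum_prod, ← tsum_mul_left]
  refine tsum_congr fun r => ?_
  rw [← tsum_durfee hq (2 * r + t), ← tsum_mul_right]
  refine tsum_congr fun d => ?_
  rw [hF]
  dsimp only
  rw [← add_assoc d]
  ring

/-! ### The multisum as an iterated Bailey chain. -/

/-- The exponent of `q` contributed by the summation variable `N_{j+1} = x`. -/
def weightExp (i ℓ j x : ℕ) : ℕ := x ^ 2 + 2 * ℓ * x + if j < i then 0 else x

/-- The general term of the multisum in `k + 1` variables, with natural exponents. -/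
noncomputable def chainTerm (q : ℂ) (ℓ k i : ℕ) (n : Fin (k + 1) → ℕ) : ℂ :=
  (∏ j : Fin (k + 1), q ^ weightExp i ℓ j (N n j) * invPoch q (n j)) *
    (invPoch q (n (Fin.last k) + 2 * ℓ) * lastRatio q ℓ (n (Fin.last k)))

theorem N_zero {k : ℕ} (n : Fin (k + 1) → ℕ) : N n 0 = ∑ j, n j := by
  simp [N]

theorem N_cons_succ {k : ℕ} (a : ℕ) (n : Fin k → ℕ) (j : Fin k) :
    N (Fin.cons a n : Fin (k + 1) → ℕ) j.succ = N n j := by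
  simp [N, sum_filter, Fin.sum_univ_succ]

theorem le_N {k : ℕ} (n : Fin k → ℕ) (j : Fin k) : n j ≤ N n j :=
  single_le_sum (f := n) (fun _ _ => Nat.zero_le _) (by simp)

theorem le_weightExp (i ℓ j x : ℕ) : x ≤ weightExp i ℓ j x := by
  unfold weightExp
  nlinarith [Nat.zero_le (2 * ℓ * x), Nat.zero_le (if j < i then 0 else x), Nat.le_self_pow two_ne_zero x]

theorem multisumTerm_eq_chainTerm (k i ℓ : ℕ) (hk : 1 ≤ k + 1) (q : ℂ) (n : Fin (k + 1) → ℕ) :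
    multisumTerm (k + 1) i ℓ hk q n = chainTerm q ℓ k i n := by
  -- The natural subtraction is exact because N_j ≤ N_j².
  have hexp : (∑ j, (N n j : ℤ) ^ 2) -
      ∑ j ∈ univ.filter (fun j : Fin (k + 1) => (j : ℕ) < i), (N n j : ℤ) =
      ((∑ j : Fin (k + 1), (N n j ^ 2 - if (j : ℕ) < i then N n j else 0) : ℕ) : ℤ) := by
    rw [sum_filter, ← sum_sub_distrib, Nat.cast_sum]
    refine sum_congr rfl fun j _ => ?_
    rw [Nat.cast_sub]
    · push_cast; rfl
    · split_ifs
      · exact Nat.le_self_pow two_ne_zero _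
      · exact Nat.zero_le _
  have hw : (2 * ℓ + 1) * ∑ j, N n j +
      ∑ j : Fin (k + 1), (N n j ^ 2 - if (j : ℕ) < i then N n j else 0) =
      ∑ j : Fin (k + 1), weightExp i ℓ j (N n j) := by
    rw [mul_sum, ← sum_add_distrib]
    refine sum_congr rfl fun j _ => ?_
    have := Nat.le_self_pow two_ne_zero (N n j)
    unfold weightExp
    rw [add_mul]
    split_ifs <;> omega
  have hlast : (⟨k + 1 - 1, by omega⟩ : Fin (k + 1)) = Fin.last k := rfl
  rw [multisumTerm, hexp, zpow_natCast, ← pow_mul, ← pow_add, hw, hlast, chainTerm,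
    prod_mul_distrib, prod_pow_eq_pow_sum]
  simp only [invPoch, prod_inv_distrib, div_eq_mul_inv, mul_inv]
  ring

/-- Removing n_1 leaves N_2, N_3, … unchanged but moves each one position down, hence `i - 1`;
truncation at i = 0 is harmless, since no position is below 0. -/
theorem chainTerm_cons (q : ℂ) (ℓ k i a : ℕ) (n : Fin (k + 1) → ℕ) :
    chainTerm q ℓ (k + 1) i (Fin.cons a n : Fin (k + 2) → ℕ) =
      q ^ weightExp i ℓ 0 (a + ∑ j, n j) * (invPoch q a * chainTerm q ℓ k (i - 1) n) := by
  have hw : ∀ j x, weightExp i ℓ (j + 1) x = weightExp (i - 1) ℓ j x := by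
    intro j x
    simp only [weightExp, Nat.lt_sub_iff_add_lt]
  rw [chainTerm, Fin.prod_univ_succ, ← Fin.succ_last, N_zero, Fin.sum_univ_succ]
  simp only [Fin.cons_zero, Fin.cons_succ, N_cons_succ, Fin.val_zero, Fin.val_succ, hw]
  rw [chainTerm]
  ring

theorem summable_prod_pow {r : ℝ} (h0 : 0 ≤ r) (h1 : r < 1) (k : ℕ) :
    Summable fun n : Fin k → ℕ => ∏ j, r ^ n j := by
  induction k with
  | zero => exact Summable.of_finite
  | succ k ih =>
    rw [← (Fin.consEquiv fun _ => ℕ).summable_iff]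
    simpa [Function.comp_def, Fin.prod_univ_succ, Fin.consEquiv] using!
      (summable_geometric_of_lt_one h0 h1).mul_of_nonneg ih (fun _ => by positivity)
        (fun _ => prod_nonneg fun _ _ => by positivity)

theorem norm_lastRatio_le {q : ℂ} (hq : ‖q‖ < 1) (ℓ m : ℕ) :
    ‖lastRatio q ℓ m‖ ≤ 2 / (1 - ‖q‖) := by
  have h0 : 0 < 1 - ‖q‖ := sub_pos.mpr hq
  have hle : ∀ n : ℕ, ‖q ^ n‖ ≤ 1 := fun n => by
    simpa using norm_pow_le_pow_of_le hq (Nat.zero_le n)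
  unfold lastRatio
  split_ifs with h
  · rw [norm_one, le_div_iff₀ h0]
    linarith [norm_nonneg q]
  · rw [norm_div]
    gcongr
    · exact (norm_sub_le _ _).trans (by rw [norm_one]; linarith [hle ℓ])
    · have h1 := norm_sub_norm_le 1 (q ^ (ℓ + m))
      have h2 : ‖q ^ (ℓ + m)‖ ≤ ‖q‖ ^ 1 := norm_pow_le_pow_of_le hq (by omega)
      rw [norm_one] at h1
      linarith

theorem summable_chainTerm {q : ℂ} (hq : ‖q‖ < 1) (ℓ k i : ℕ) :
    Summable (chainTerm q ℓ k i) := by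
  obtain ⟨C, hC1, hC⟩ := exists_norm_invPoch_le hq
  have h0 : 0 < 1 - ‖q‖ := sub_pos.mpr hq
  refine Summable.of_norm_bounded
    (((summable_prod_pow (norm_nonneg q) hq (k + 1)).mul_right (C ^ (k + 1))).mul_right
      (C * (2 / (1 - ‖q‖)))) fun n => ?_
  rw [chainTerm, norm_mul, norm_mul, norm_prod]
  gcongr
  · calc ∏ j : Fin (k + 1), ‖q ^ weightExp i ℓ j (N n j) * invPoch q (n j)‖ ≤ ∏ j, ‖q‖ ^ n j * C := by
          refine prod_le_prod (fun _ _ => norm_nonneg _) fun j _ => ?_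
          rw [norm_mul]
          gcongr
          · exact norm_pow_le_pow_of_le hq ((le_N n j).trans (le_weightExp _ _ _ _))
          · exact hC _
      _ = _ := by simp [prod_mul_distrib]
  · exact hC _
  · exact norm_lastRatio_le hq _ _

theorem sum_antidiagonalTuple_succ (k M : ℕ) (f : (Fin (k + 1) → ℕ) → ℂ) :
    ∑ n ∈ Nat.antidiagonalTuple (k + 1) M, f n =
      ∑ x ∈ antidiagonal M, ∑ n ∈ Nat.antidiagonalTuple k x.2, f (Fin.cons x.1 n) := by
  rw [sum_sigma']
  symm
  refine sum_nbij' (fun x => Fin.cons x.1.1 x.2)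
    (fun n => ⟨(n 0, ∑ j : Fin k, n j.succ), Fin.tail n⟩) ?_ ?_ ?_ ?_ ?_
  · rintro ⟨⟨a, b⟩, n⟩ h
    simp only [mem_sigma, HasAntidiagonal.mem_antidiagonal, Nat.mem_antidiagonalTuple] at h
    simp [Nat.mem_antidiagonalTuple, Fin.sum_univ_succ, h.2, h.1]
  · intro n h
    rw [Nat.mem_antidiagonalTuple, Fin.sum_univ_succ] at h
    simp [Nat.mem_antidiagonalTuple, Fin.tail, h]
  · rintro ⟨⟨a, b⟩, n⟩ h
    simp only [mem_sigma, HasAntidiagonal.mem_antidiagonal, Nat.mem_antidiagonalTuple] at h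
    obtain ⟨h1, rfl⟩ := h
    simp
  · intro n _
    exact Fin.cons_self_tail n
  · intro x _
    rfl

theorem sum_chainTerm_zero (q : ℂ) (ℓ i M : ℕ) :
    ∑ n ∈ Nat.antidiagonalTuple 1 M, chainTerm q ℓ 0 i n =
      q ^ weightExp i ℓ 0 M * (invPoch q M * invPoch q (M + 2 * ℓ) * lastRatio q ℓ M) := by
  simp [chainTerm, N]
  ring

/-- Fixing the total M = N_1 pulls out the outermost weight and leaves a sum over N_2 of the shape
treated by `bailey_step`. -/
theorem sum_chainTerm_succ (q : ℂ) (ℓ k i M : ℕ) :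
    ∑ n ∈ Nat.antidiagonalTuple (k + 2) M, chainTerm q ℓ (k + 1) i n =
      q ^ weightExp i ℓ 0 M * ∑ x ∈ antidiagonal M,
        invPoch q x.1 * ∑ n ∈ Nat.antidiagonalTuple (k + 1) x.2, chainTerm q ℓ k (i - 1) n := by
  rw [sum_antidiagonalTuple_succ, mul_sum]
  refine sum_congr rfl fun x hx => ?_
  rw [mul_sum, mul_sum]
  refine sum_congr rfl fun n hn => ?_
  rw [chainTerm_cons, Nat.mem_antidiagonalTuple.mp hn, HasAntidiagonal.mem_antidiagonal.mp hx]

/-- The first member of the Bailey pair after `p` steps of the chain relative to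
`q ^ (2 * ℓ + 1)`, without the factor `1 - q ^ (2 * r + 2 * ℓ + 1)`. -/
noncomputable def chainCoeff (q : ℂ) (ℓ p r : ℕ) : ℂ :=
  (-1) ^ r * q ^ (r.choose 2 + ℓ * r + p * (r ^ 2 + (2 * ℓ + 1) * r))

theorem chainCoeff_succ (q : ℂ) (ℓ p r : ℕ) :
    q ^ (r ^ 2 + (2 * ℓ + 1) * r) * chainCoeff q ℓ p r = chainCoeff q ℓ (p + 1) r := by
  simp only [chainCoeff]
  ring

theorem norm_chainCoeff_le {q : ℂ} (hq : ‖q‖ < 1) (ℓ p r : ℕ) : ‖chainCoeff q ℓ p r‖ ≤ 1 := by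
  simpa [chainCoeff] using pow_le_one₀ (norm_nonneg q) hq.le

/-- Since the outermost weight stays outside, i = 0 and i = 1 share the same inner sum, and all
chain steps are relative to q^(2ℓ+1). -/
theorem sum_chainTerm_of_le_one {q : ℂ} (hq : ‖q‖ < 1) (ℓ k M : ℕ) {i : ℕ} (hi : i ≤ 1) :
    ∑ n ∈ Nat.antidiagonalTuple (k + 1) M, chainTerm q ℓ k i n =
      q ^ weightExp i ℓ 0 M *
        bailey q (2 * ℓ + 1) (fun r => (1 - q ^ (2 * r + 2 * ℓ + 1)) * chainCoeff q ℓ k r) M := by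
  induction k generalizing i M with
  | zero =>
    rw [sum_chainTerm_zero, bailey_base hq]
    congr 2
    ext r
    simp only [chainCoeff]
    ring
  | succ k ih =>
    rw [sum_chainTerm_succ, show i - 1 = 0 by omega]
    simp only [ih _ (Nat.zero_le 1)]
    have hw : ∀ x, weightExp 0 ℓ 0 x = x ^ 2 + (2 * ℓ + 1) * x := fun x => by
      simp [weightExp]; ring
    simp only [hw, bailey_step hq]
    congr 2
    ext r
    rw [← chainCoeff_succ]
    ring

/-- After p steps relative to q^(2ℓ+1) the base is changed, and i further steps are relative to
q^(2ℓ). The outermost weight is again left for the limit. -/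
theorem sum_chainTerm_add {q : ℂ} (hq : ‖q‖ < 1) (ℓ p i M : ℕ) :
    ∑ n ∈ Nat.antidiagonalTuple (p + i + 1) M, chainTerm q ℓ (p + i) (i + 1) n =
      q ^ (M ^ 2 + 2 * ℓ * M) * bailey q (2 * ℓ) (fun r => q ^ (i * (r ^ 2 + 2 * ℓ * r)) *
        (chainCoeff q ℓ p r -
          if r = 0 then 0 else q ^ (2 * r - 1 + 2 * ℓ) * chainCoeff q ℓ p (r - 1))) M := by
  have hw : ∀ i x, weightExp (i + 1) ℓ 0 x = x ^ 2 + 2 * ℓ * x := fun i x => by simp [weightExp]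
  induction i generalizing M with
  | zero =>
    rw [add_zero, sum_chainTerm_of_le_one hq ℓ p M le_rfl, hw, bailey_change_base hq]
    simp
  | succ i ih =>
    rw [← add_assoc p i 1, sum_chainTerm_succ, Nat.add_sub_cancel, hw]
    simp only [ih, bailey_step hq]
    congr 2
    ext r
    ring

theorem tsum_chainTerm_eq_tsum_sum {q : ℂ} (hq : ‖q‖ < 1) (ℓ k i : ℕ) :
    ∑' n, chainTerm q ℓ k i n =
      ∑' M : ℕ, ∑ n ∈ Nat.antidiagonalTuple (k + 1) M, chainTerm q ℓ k i n := by
  have hs : Summable fun c : Σ M, Nat.antidiagonalTuple (k + 1) M =>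
      chainTerm q ℓ k i (Nat.sigmaAntidiagonalTupleEquivTuple (k + 1) c) :=
    (Nat.sigmaAntidiagonalTupleEquivTuple (k + 1)).summable_iff.mpr (summable_chainTerm hq ℓ k i)
  rw [← (Nat.sigmaAntidiagonalTupleEquivTuple (k + 1)).tsum_eq,
    hs.tsum_sigma' fun M => Summable.of_finite]
  refine tsum_congr fun M => ?_
  rw [tsum_fintype]
  exact sum_coe_sort (Nat.antidiagonalTuple (k + 1) M) (chainTerm q ℓ k i)

theorem summable_pow_mul_chainCoeff {q : ℂ} (hq : ‖q‖ < 1) (ℓ p : ℕ) {e : ℕ → ℕ}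
    (he : ∀ r, r ≤ e r + p * (r ^ 2 + (2 * ℓ + 1) * r)) :
    Summable fun r => q ^ e r * chainCoeff q ℓ p r := by
  refine Summable.of_norm_bounded (summable_geometric_of_lt_one (norm_nonneg q) hq) fun r => ?_
  have h : q ^ e r * chainCoeff q ℓ p r =
      (-1) ^ r * q ^ (e r + (r.choose 2 + ℓ * r + p * (r ^ 2 + (2 * ℓ + 1) * r))) := by
    rw [chainCoeff, pow_add q (e r)]
    ring
  rw [h, norm_mul, norm_pow, norm_neg, norm_one, one_pow, one_mul]
  exact norm_pow_le_pow_of_le hq ((he r).trans (by omega))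

theorem tsum_chainTerm {q : ℂ} (hq : ‖q‖ < 1) (ℓ k i : ℕ) (hi : i ≤ k + 1) :
    ∑' n, chainTerm q ℓ k i n = (qPochInf q q)⁻¹ *
      (∑' r, q ^ (i * (r ^ 2 + 2 * ℓ * r)) * chainCoeff q ℓ (k + 1 - i) r -
        ∑' r, q ^ (i * ((r + 1) ^ 2 + 2 * ℓ * (r + 1)) + (2 * r + 2 * ℓ + 1)) *
          chainCoeff q ℓ (k + 1 - i) r) := by
  have hle : ∀ n : ℕ, ‖q ^ n‖ ≤ 1 := fun n => by
    simpa using norm_pow_le_pow_of_le hq (Nat.zero_le n)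
  rw [tsum_chainTerm_eq_tsum_sum hq]
  rcases i with _ | i
  · simp only [sum_chainTerm_of_le_one hq ℓ k _ zero_le_one, weightExp, Nat.not_lt_zero, if_false,
      show ∀ M, M ^ 2 + 2 * ℓ * M + M = M ^ 2 + (2 * ℓ + 1) * M from fun M => by ring]
    rw [tsum_bailey hq (2 * ℓ + 1) (A := 2), ← Summable.tsum_sub]
    · congr 2
      ext r
      rw [Nat.sub_zero, ← chainCoeff_succ]
      ring
    · refine summable_pow_mul_chainCoeff hq ℓ _ fun r => ?_
      rw [Nat.sub_zero]
      nlinarith [Nat.zero_le (k * (r ^ 2 + (2 * ℓ + 1) * r)), Nat.zero_le (ℓ * r)]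
    · refine summable_pow_mul_chainCoeff hq ℓ _ fun r => ?_
      omega
    · intro r
      rw [norm_mul]
      have h1 := norm_chainCoeff_le hq ℓ k r
      have h2 := norm_sub_le 1 (q ^ (2 * r + 2 * ℓ + 1))
      have h3 := hle (2 * r + 2 * ℓ + 1)
      rw [norm_one] at h2
      nlinarith [norm_nonneg (chainCoeff q ℓ k r)]
  · obtain ⟨p, rfl⟩ : ∃ p, k = p + i := ⟨k - i, by omega⟩
    rw [show p + i + 1 - (i + 1) = p by omega]
    simp only [sum_chainTerm_add hq]
    -- The contribution of γ_(r-1) from the change of base. It vanishes at 0, so its sum can be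
    -- reindexed by r + 1.
    set g : ℕ → ℂ := fun r => q ^ ((i + 1) * (r ^ 2 + 2 * ℓ * r)) *
      if r = 0 then 0 else q ^ (2 * r - 1 + 2 * ℓ) * chainCoeff q ℓ p (r - 1) with hg
    have hg0 : g 0 = 0 := by simp [hg]
    have hgs : ∀ r, g (r + 1) =
        q ^ ((i + 1) * ((r + 1) ^ 2 + 2 * ℓ * (r + 1)) + (2 * r + 2 * ℓ + 1)) *
          chainCoeff q ℓ p r := by
      intro r
      simp only [hg, Nat.add_one_ne_zero, if_false, Nat.add_sub_cancel]
      rw [← mul_assoc, ← pow_add, show 2 * (r + 1) - 1 + 2 * ℓ = 2 * r + 2 * ℓ + 1 by omega]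
    have hsum : Summable fun r => g (r + 1) := by
      simp only [hgs]
      exact summable_pow_mul_chainCoeff hq ℓ _ fun r => by omega
    rw [tsum_bailey hq (2 * ℓ) (A := 2)]
    · have hgt := tsum_eq_zero_add' hsum
      rw [hg0, zero_add] at hgt
      simp only [← hgs]
      rw [← hgt, ← Summable.tsum_sub _ ((summable_nat_add_iff 1).mp hsum)]
      · congr 2
        ext r
        simp only [hg]
        ring
      · refine summable_pow_mul_chainCoeff hq ℓ _ fun r => ?_
        nlinarith [Nat.zero_le (i * (r ^ 2 + 2 * ℓ * r)), Nat.zero_le (ℓ * r),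
          Nat.le_self_pow two_ne_zero r, Nat.zero_le (p * (r ^ 2 + (2 * ℓ + 1) * r))]
    · intro r
      rw [norm_mul]
      have h0 := hle (i * (r ^ 2 + 2 * ℓ * r))
      have h1 : ‖chainCoeff q ℓ p r - if r = 0 then 0
          else q ^ (2 * r - 1 + 2 * ℓ) * chainCoeff q ℓ p (r - 1)‖ ≤ 1 + 1 := by
        refine (norm_sub_le _ _).trans (add_le_add (norm_chainCoeff_le hq ℓ p r) ?_)
        split_ifs
        · simp
        · rw [norm_mul]
          exact mul_le_one₀ (hle _) (norm_nonneg _) (norm_chainCoeff_le hq ℓ p _)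
      nlinarith [norm_nonneg (q ^ (i * (r ^ 2 + 2 * ℓ * r)))]

/-! ### The Jacobi triple product. -/

/-- The finite `q`-binomial theorem, in homogeneous form. -/
theorem prod_add_mul_pow {p : ℂ} (hp : ‖p‖ < 1) (a b : ℂ) (n : ℕ) :
    ∏ m ∈ range n, (b + a * p ^ m) = qPoch p p n * ∑ x ∈ antidiagonal n,
      p ^ x.1.choose 2 * a ^ x.1 * b ^ x.2 * invPoch p x.1 * invPoch p x.2 := by
  induction n with
  | zero => simp [qPoch]
  | succ n ih =>
    have hsplit : ∀ x ∈ antidiagonal (n + 1), (1 - p ^ (n + 1)) *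
        (p ^ x.1.choose 2 * a ^ x.1 * b ^ x.2 * invPoch p x.1 * invPoch p x.2) =
        (1 - p ^ x.2) * (invPoch p x.2 *
          (p ^ x.1.choose 2 * a ^ x.1 * b ^ x.2 * invPoch p x.1)) +
        (1 - p ^ x.1) * (invPoch p x.1 *
          (p ^ (x.2 + x.1.choose 2) * a ^ x.1 * b ^ x.2 * invPoch p x.2)) := by
      intro x hx
      rw [← HasAntidiagonal.mem_antidiagonal.mp hx]
      ring
    rw [prod_range_succ, ih, qPoch_succ, mul_assoc, mul_assoc, mul_sum (a := 1 - p ^ (n + 1)),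
      sum_congr rfl hsplit, sum_add_distrib,
      sum_antidiagonal_one_sub_snd hp n
        (fun r s => p ^ r.choose 2 * a ^ r * b ^ s * invPoch p r),
      sum_antidiagonal_one_sub_fst hp n
        (fun r s => p ^ (s + r.choose 2) * a ^ r * b ^ s * invPoch p s), ← sum_add_distrib, sum_mul]
    congr 1
    refine sum_congr rfl fun x hx => ?_
    rw [← HasAntidiagonal.mem_antidiagonal.mp hx, Nat.choose_succ_succ' x.1 1, Nat.choose_one_right]
    ring

/-- The finite form of the Jacobi triple product identity. -/
theorem finite_jacobi_triple_product {p x y : ℂ} (hp : ‖p‖ < 1) (hp0 : p ≠ 0) (hxy : x * y = p)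
    {u : ℤ → ℂ} (hu0 : u 0 = 1) (hu : ∀ j, u (j + 1) = -x * p ^ j * u j) (n : ℕ) :
    qPoch x p n * qPoch y p n = qPoch p p (2 * n) *
      ∑ r ∈ range (2 * n + 1), u (r - n) * invPoch p r * invPoch p (2 * n - r) := by
  have hx0 : x ≠ 0 := by rintro rfl; exact hp0 (by rw [← hxy, zero_mul])
  -- The recursion means u j = (-x)^j p^(j(j-1)/2). Here and in `hterm` this is stated with
  -- denominators cleared, as needed to match the q-binomial theorem.
  have hneg : (-x) ^ n * p ^ (n.choose 2 + n ^ 2) * u (-n) = p ^ (2 * n ^ 2) := by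
    induction n with
    | zero => simp [hu0]
    | succ n ih =>
      have h := hu (-((n + 1 : ℕ) : ℤ))
      rw [zpow_neg, zpow_natCast, show -((n + 1 : ℕ) : ℤ) + 1 = -(n : ℤ) by push_cast; ring] at h
      have h' : -x * u (-((n + 1 : ℕ) : ℤ)) = p ^ (n + 1) * u (-(n : ℤ)) := by
        rw [h]
        field_simp
      rw [Nat.choose_succ_succ' n 1, Nat.choose_one_right]
      linear_combination (-x) ^ n * p ^ (n.choose 2 + n + (n + 1) ^ 2) * h' +
        p ^ (4 * n + 2) * ih
  have hterm : ∀ r : ℕ, (-x) ^ n * p ^ (n.choose 2 + n ^ 2) * u (r - n) * p ^ (n * r) =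
      (-x) ^ r * p ^ (r.choose 2 + 2 * n ^ 2) := by
    intro r
    induction r with
    | zero => simpa using hneg
    | succ r ih =>
      have h := hu ((r : ℤ) - n)
      rw [zpow_sub₀ hp0, zpow_natCast, zpow_natCast] at h
      have h' : p ^ n * u ((r + 1 : ℕ) - n) = -x * p ^ r * u (r - n) := by
        rw [show (((r + 1 : ℕ) : ℤ) - n) = (r : ℤ) - n + 1 by push_cast; ring, h]
        field_simp
      rw [Nat.choose_succ_succ' r 1, Nat.choose_one_right]
      linear_combination (-x) ^ n * p ^ (n.choose 2 + n ^ 2) * p ^ (n * r) * h' +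
        (-x) * p ^ r * ih
  have hlow : ∀ m : ℕ, ∏ j ∈ range m, (p ^ m + -x * p ^ j) =
      (-x) ^ m * p ^ m.choose 2 * qPoch y p m := by
    intro m
    have hx : (-x) ^ m = ∏ _j ∈ range m, -x := by rw [prod_const, card_range]
    rw [qPoch, ← prod_range_reflect (fun j => 1 - y * p ^ j), Nat.choose_two_right,
      ← sum_range_id, ← prod_pow_eq_pow_sum, hx, ← prod_mul_distrib, ← prod_mul_distrib]
    refine prod_congr rfl fun j hj => ?_
    have hj := mem_range.mp hj
    have : p ^ m = p ^ j * p ^ (m - 1 - j) * (x * y) := by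
      rw [hxy, ← pow_add, ← pow_succ]
      congr 1
      omega
    rw [this]
    ring
  -- The factors with m ≥ n give (x;p)_n; those with m < n, read backwards with y = p/x, give
  -- (y;p)_n.
  have hprod : ∏ m ∈ range (2 * n), (p ^ n + -x * p ^ m) =
      (-x) ^ n * p ^ (n.choose 2 + n ^ 2) * (qPoch x p n * qPoch y p n) := by
    rw [two_mul, prod_range_add, hlow n]
    have : ∏ j ∈ range n, (p ^ n + -x * p ^ (n + j)) = p ^ n ^ 2 * qPoch x p n := by
      have hpn : p ^ n ^ 2 = ∏ _j ∈ range n, p ^ n := by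
        rw [prod_const, card_range, ← pow_mul, pow_two]
      rw [qPoch, hpn, ← prod_mul_distrib]
      refine prod_congr rfl fun j _ => ?_
      ring
    rw [this]
    ring
  have hc : (-x) ^ n * p ^ (n.choose 2 + n ^ 2) ≠ 0 :=
    mul_ne_zero (pow_ne_zero _ (neg_ne_zero.mpr hx0)) (pow_ne_zero _ hp0)
  apply mul_left_cancel₀ hc
  rw [← hprod, prod_add_mul_pow hp, Nat.sum_antidiagonal_eq_sum_range_succ_mk, mul_left_comm]
  congr 1
  rw [mul_sum]
  refine sum_congr rfl fun r hr => ?_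
  have hr := mem_range.mp hr
  apply mul_left_cancel₀ (pow_ne_zero (n * r) hp0)
  have hpow : p ^ (n * r) * (p ^ n) ^ (2 * n - r) = p ^ (2 * n ^ 2) := by
    rw [pow_mul, ← pow_add, ← pow_mul]
    congr 1
    rw [show r + (2 * n - r) = 2 * n by omega]
    ring
  linear_combination (p ^ r.choose 2 * (-x) ^ r * invPoch p r * invPoch p (2 * n - r)) * hpow -
    invPoch p r * invPoch p (2 * n - r) * hterm r

/-- The limit n → ∞ of the finite form, recentred at j = r - n; bounded `invPoch` and summable `u`
give the domination. -/
theorem jacobi_triple_product {p x y : ℂ} (hp : ‖p‖ < 1) (hp0 : p ≠ 0) (hxy : x * y = p)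
    {u : ℤ → ℂ} (hu0 : u 0 = 1) (hu : ∀ j, u (j + 1) = -x * p ^ j * u j)
    (hs : Summable fun j => ‖u j‖) :
    ∑' j, u j = qPochInf x p * qPochInf y p * qPochInf p p := by
  obtain ⟨C, hC1, hC⟩ := exists_norm_invPoch_le hp
  have hR := tendsto_invPoch hp
  have hP := qPochInf_ne_zero hp hp
  set f : ℕ → ℤ → ℂ := fun n j => if j ∈ Icc (-(n : ℤ)) n then
    u j * invPoch p (n + j).toNat * invPoch p (n - j).toNat else 0
  have hf : ∀ n, ∑' j, f n j = qPoch x p n * qPoch y p n * invPoch p (2 * n) := by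
    intro n
    rw [finite_jacobi_triple_product hp hp0 hxy hu0 hu n, mul_right_comm, invPoch,
      mul_inv_cancel₀ (qPoch_ne_zero hp _), one_mul,
      tsum_eq_sum (s := Icc (-(n : ℤ)) n) fun j hj => if_neg hj]
    symm
    refine sum_nbij' (fun r => (r : ℤ) - n) (fun j => (n + j).toNat) ?_ ?_ ?_ ?_ ?_
    · intro r hr
      rw [mem_range] at hr
      rw [mem_Icc]
      omega
    · intro j hj
      rw [mem_Icc] at hj
      rw [mem_range]
      omega
    · intro r hr
      omega
    · intro j hj
      rw [mem_Icc] at hj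
      omega
    · intro r hr
      rw [mem_range] at hr
      rw [if_pos (by rw [mem_Icc]; omega), show ((n : ℤ) + (r - n)).toNat = r by omega,
        show ((n : ℤ) - (r - n)).toNat = 2 * n - r by omega]
  have hbound : ∀ n j, ‖f n j‖ ≤ ‖u j‖ * C * C := by
    intro n j
    dsimp only [f]
    split_ifs
    · rw [norm_mul, norm_mul]
      gcongr
      all_goals exact hC _
    · rw [norm_zero]; positivity
  have hlim := tendsto_tsum_of_dominated_convergence (𝓕 := atTop) (f := f)
    (g := fun j => u j * (qPochInf p p)⁻¹ * (qPochInf p p)⁻¹) ((hs.mul_right C).mul_right C)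
    (fun j => by
      have h1 : Tendsto (fun n : ℕ => ((n : ℤ) + j).toNat) atTop atTop :=
        tendsto_atTop.mpr fun b => by
          filter_upwards [eventually_ge_atTop (b + j.natAbs)] with n hn
          omega
      have h2 : Tendsto (fun n : ℕ => ((n : ℤ) - j).toNat) atTop atTop :=
        tendsto_atTop.mpr fun b => by
          filter_upwards [eventually_ge_atTop (b + j.natAbs)] with n hn
          omega
      refine Tendsto.congr' ?_ (((hR.comp h1).const_mul (u j)).mul (hR.comp h2))
      filter_upwards [eventually_ge_atTop j.natAbs] with n hn
      exact (if_pos (by rw [mem_Icc]; omega)).symm)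
    (Eventually.of_forall fun n j => hbound n j)
  simp only [hf] at hlim
  have h2n : Tendsto (fun n : ℕ => 2 * n) atTop atTop :=
    tendsto_id.const_mul_atTop' two_pos
  have h := tendsto_nhds_unique hlim
    (((tendsto_qPoch hp x).mul (tendsto_qPoch hp y)).mul (hR.comp h2n))
  rw [tsum_mul_right, tsum_mul_right] at h
  field_simp at h
  linear_combination h

/-! ### The theta series and its tail. -/

theorem two_mul_thetaExp (k i : ℕ) (j : ℤ) :
    2 * thetaExp k i j = (2 * k + 1) * j ^ 2 + (2 * k - 2 * i - 1) * j := by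
  have h := thetaExp_cast k i j
  have : ((2 * thetaExp k i j : ℤ) : ℚ) =
      (((2 * k + 1) * j ^ 2 + (2 * k - 2 * i - 1) * j : ℤ) : ℚ) := by
    push_cast
    rw [h]
    ring
  exact_mod_cast this

theorem thetaExp_add_one (k i : ℕ) (j : ℤ) :
    thetaExp k i (j + 1) = thetaExp k i j + ((2 * k + 1) * j + (2 * k - i)) := by
  linarith [two_mul_thetaExp k i j, two_mul_thetaExp k i (j + 1)]

/-- Twice the exponent is (2k+1)j(j-1) + 2(2k-i)j, and also (2k+1)j(j+1) - 2(i+1)j; these serve for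
j ≥ 0 and j < 0. -/
theorem natAbs_le_thetaExp {k i : ℕ} (hk : 1 ≤ k) (hi : i ≤ k) (j : ℤ) :
    (j.natAbs : ℤ) ≤ thetaExp k i j := by
  have h := two_mul_thetaExp k i j
  zify at hk hi
  rcases le_or_gt 0 j with hj | hj
  · rw [Int.natAbs_of_nonneg hj]
    have h1 : 0 ≤ j * (j - 1) := by
      rcases hj.eq_or_lt with rfl | hj
      · simp
      · exact mul_nonneg (by omega) (by omega)
    nlinarith [mul_nonneg (show (0 : ℤ) ≤ 2 * k + 1 by omega) h1,
      mul_nonneg hj (show (0 : ℤ) ≤ 2 * k - i - 1 by omega)]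
  · rw [Int.ofNat_natAbs_of_nonpos hj.le]
    have h1 : 0 ≤ j * (j + 1) := mul_nonneg_of_nonpos_of_nonpos hj.le (by omega)
    nlinarith [mul_nonneg (show (0 : ℤ) ≤ 2 * k + 1 by omega) h1,
      mul_nonneg (show (0 : ℤ) ≤ -j by omega) (Int.natCast_nonneg i)]

/-- The general term `(-1) ^ j q ^ ((k + 1/2) j ^ 2 + (k - i - 1/2) j)` of the theta series. -/
noncomputable def thetaTerm (q : ℂ) (k i : ℕ) (j : ℤ) : ℂ :=
  (-1 : ℂ) ^ j * q ^ thetaExp k i j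

theorem thetaTerm_eq (q : ℂ) {k i : ℕ} {j : ℤ} {m a : ℕ} (h : thetaExp k i j = a)
    (hm : (-1 : ℂ) ^ j = (-1) ^ m) : thetaTerm q k i j = (-1) ^ m * q ^ a := by
  rw [thetaTerm, h, hm, zpow_natCast]

theorem norm_thetaTerm_le {q : ℂ} (hq : ‖q‖ < 1) {k i : ℕ} (hk : 1 ≤ k) (hi : i ≤ k) (j : ℤ) :
    ‖thetaTerm q k i j‖ ≤ ‖q‖ ^ j.natAbs := by
  have h := natAbs_le_thetaExp hk hi j
  obtain ⟨n, hn⟩ := Int.eq_ofNat_of_zero_le (h.trans' (Int.natCast_nonneg _))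
  rw [hn, Nat.cast_le] at h
  rw [thetaTerm, norm_mul, norm_zpow, norm_neg, norm_one, one_zpow, one_mul, hn, zpow_natCast]
  exact norm_pow_le_pow_of_le hq h

theorem summable_norm_thetaTerm {q : ℂ} (hq : ‖q‖ < 1) {k i : ℕ} (hk : 1 ≤ k) (hi : i ≤ k) :
    Summable fun j => ‖thetaTerm q k i j‖ := by
  have hgeo := summable_geometric_of_lt_one (norm_nonneg q) hq
  refine Summable.of_nonneg_of_le (fun _ => norm_nonneg _) (norm_thetaTerm_le hq hk hi) ?_
  exact Summable.of_nat_of_neg (by simpa using hgeo) (by simpa using hgeo)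

theorem tsum_thetaTerm {q : ℂ} (hq : ‖q‖ < 1) {k i : ℕ} (hk : 1 ≤ k) (hi : i ≤ k) :
    ∑' j, thetaTerm q k i j = tripleProd k i q := by
  have h0 : thetaTerm q k i 0 = 1 := by simp [thetaTerm, thetaExp]
  -- The triple product lemma needs p = q^(2k+1) ≠ 0; at q = 0 only j = 0 survives, because the
  -- other exponents are positive.
  rcases eq_or_ne q 0 with rfl | hq0
  · rw [tsum_eq_single 0 fun j hj => ?_, h0]
    · simp [tripleProd, qPochInf, show 2 * k - i ≠ 0 by omega]
    · have h := natAbs_le_thetaExp hk hi j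
      rw [thetaTerm, zero_zpow _ (by omega), mul_zero]
  · have hp0 : q ^ (2 * k + 1) ≠ 0 := pow_ne_zero _ hq0
    have hp : ‖q ^ (2 * k + 1)‖ < 1 := by
      rw [norm_pow]
      exact pow_lt_one₀ (norm_nonneg q) hq (by omega)
    rw [jacobi_triple_product (x := q ^ (2 * k - i)) (y := q ^ (i + 1)) hp hp0 ?_ h0 ?_
      (summable_norm_thetaTerm hq hk hi), tripleProd,
      mul_comm (qPochInf (q ^ (2 * k - i)) _)]
    · rw [← pow_add]
      congr 1
      omega
    · intro j
      rw [thetaTerm, thetaTerm, thetaExp_add_one, zpow_add₀ hq0, zpow_add₀ hq0,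
        zpow_add_one₀ (by norm_num : (-1 : ℂ) ≠ 0), ← zpow_natCast q (2 * k + 1), ← zpow_mul,
        ← zpow_natCast q (2 * k - i), Nat.cast_sub (by omega)]
      push_cast
      ring

/-- The prefactor of the multisum thus carries the power of q in the j = ℓ theta term. -/
theorem prefExp_eq_thetaExp (k i ℓ : ℕ) : prefExp k i ℓ = thetaExp k i ℓ := by
  have : (prefExp k i ℓ : ℚ) = thetaExp k i ℓ := by
    rw [prefExp_cast, thetaExp_cast]
    push_cast
    ring
  exact_mod_cast this

theorem thetaTerm_add {q : ℂ} {k i : ℕ} (hk : 1 ≤ k) (hi : i ≤ k) (ℓ r : ℕ) :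
    thetaTerm q k i ((r + ℓ : ℕ) : ℤ) = (-1) ^ ℓ * q ^ prefExp k i ℓ *
      (q ^ (i * (r ^ 2 + 2 * ℓ * r)) * chainCoeff q ℓ (k - i) r) := by
  obtain ⟨a, ha⟩ := Int.eq_ofNat_of_zero_le
    ((natAbs_le_thetaExp hk hi ℓ).trans' (Int.natCast_nonneg _))
  have hexp : thetaExp k i ((r + ℓ : ℕ) : ℤ) = ((a + (i * (r ^ 2 + 2 * ℓ * r) +
      (r.choose 2 + ℓ * r + (k - i) * (r ^ 2 + (2 * ℓ + 1) * r))) : ℕ) : ℤ) := by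
    have haQ : (a : ℚ) = thetaExp k i ℓ := by rw [ha]; simp
    have : (thetaExp k i ((r + ℓ : ℕ) : ℤ) : ℚ) = ((a + (i * (r ^ 2 + 2 * ℓ * r) +
        (r.choose 2 + ℓ * r + (k - i) * (r ^ 2 + (2 * ℓ + 1) * r))) : ℕ) : ℚ) := by
      rw [thetaExp_cast]
      push_cast [haQ, thetaExp_cast, Nat.cast_choose_two, Nat.cast_sub hi]
      ring
    exact_mod_cast this
  rw [thetaTerm_eq q hexp (zpow_natCast _ _), prefExp_eq_thetaExp, ha,
    zpow_natCast, chainCoeff]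
  ring

/-- The terms j ≤ -ℓ-1 reproduce the subtracted series of `tsum_chainTerm`, as the terms j ≥ ℓ
reproduce the first. -/
theorem thetaTerm_neg_add {q : ℂ} {k i : ℕ} (hk : 1 ≤ k) (hi : i ≤ k) (ℓ r : ℕ) :
    thetaTerm q k i (-(((r + ℓ : ℕ) : ℤ) + 1)) = -((-1) ^ ℓ * q ^ prefExp k i ℓ) *
      (q ^ (i * ((r + 1) ^ 2 + 2 * ℓ * (r + 1)) + (2 * r + 2 * ℓ + 1)) *
        chainCoeff q ℓ (k - i) r) := by
  obtain ⟨a, ha⟩ := Int.eq_ofNat_of_zero_le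
    ((natAbs_le_thetaExp hk hi ℓ).trans' (Int.natCast_nonneg _))
  have hexp : thetaExp k i (-(((r + ℓ : ℕ) : ℤ) + 1)) =
      ((a + ((i * ((r + 1) ^ 2 + 2 * ℓ * (r + 1)) + (2 * r + 2 * ℓ + 1)) +
        (r.choose 2 + ℓ * r + (k - i) * (r ^ 2 + (2 * ℓ + 1) * r))) : ℕ) : ℤ) := by
    have haQ : (a : ℚ) = thetaExp k i ℓ := by rw [ha]; simp
    have : (thetaExp k i (-(((r + ℓ : ℕ) : ℤ) + 1)) : ℚ) =
        ((a + ((i * ((r + 1) ^ 2 + 2 * ℓ * (r + 1)) + (2 * r + 2 * ℓ + 1)) +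
          (r.choose 2 + ℓ * r + (k - i) * (r ^ 2 + (2 * ℓ + 1) * r))) : ℕ) : ℚ) := by
      rw [thetaExp_cast]
      push_cast [haQ, thetaExp_cast, Nat.cast_choose_two, Nat.cast_sub hi]
      ring
    exact_mod_cast this
  have hsign : (-1 : ℂ) ^ (-(((r + ℓ : ℕ) : ℤ) + 1)) = (-1) ^ (r + ℓ + 1) := by
    rw [zpow_neg, ← inv_zpow, inv_neg_one]
    exact_mod_cast zpow_natCast (-1 : ℂ) (r + ℓ + 1)
  rw [thetaTerm_eq q hexp hsign, prefExp_eq_thetaExp, ha, zpow_natCast,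
    chainCoeff]
  ring

theorem sum_Icc_neg_sub_one (f : ℤ → ℂ) (ℓ : ℕ) :
    ∑ j ∈ Icc (-(ℓ : ℤ)) (ℓ - 1), f j =
      ∑ j ∈ range ℓ, f j + ∑ j ∈ range ℓ, f (-((j : ℤ) + 1)) := by
  induction ℓ with
  | zero => simp
  | succ ℓ ih =>
    have h : Icc (-((ℓ + 1 : ℕ) : ℤ)) ((ℓ + 1 : ℕ) - 1) =
        insert (ℓ : ℤ) (insert (-((ℓ : ℤ) + 1)) (Icc (-(ℓ : ℤ)) (ℓ - 1))) := by
      ext j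
      simp only [mem_insert, mem_Icc]
      omega
    rw [h, sum_insert (by simp only [mem_insert, mem_Icc]; omega),
      sum_insert (by simp only [mem_Icc]; omega), ih, sum_range_succ, sum_range_succ]
    ring

theorem tripleProd_eq_sum_add {q : ℂ} (hq : ‖q‖ < 1) {k i : ℕ} (hk : 1 ≤ k) (hi : i ≤ k)
    (ℓ : ℕ) :
    tripleProd k i q = ∑ j ∈ Icc (-(ℓ : ℤ)) (ℓ - 1), thetaTerm q k i j +
      (-1) ^ ℓ * q ^ prefExp k i ℓ *
      (∑' r, q ^ (i * (r ^ 2 + 2 * ℓ * r)) * chainCoeff q ℓ (k - i) r -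
        ∑' r, q ^ (i * ((r + 1) ^ 2 + 2 * ℓ * (r + 1)) + (2 * r + 2 * ℓ + 1)) *
          chainCoeff q ℓ (k - i) r) := by
  have hs : Summable (thetaTerm q k i) := (summable_norm_thetaTerm hq hk hi).of_norm
  have h1 : Summable fun n : ℕ => thetaTerm q k i n := hs.comp_injective Nat.cast_injective
  have h2 : Summable fun n : ℕ => thetaTerm q k i (-((n : ℤ) + 1)) :=
    hs.comp_injective fun a b h => by simpa using h
  rw [← tsum_thetaTerm hq hk hi, tsum_of_nat_of_neg_add_one h1 h2, ← h1.sum_add_tsum_nat_add ℓ,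
    ← h2.sum_add_tsum_nat_add ℓ, sum_Icc_neg_sub_one]
  simp only [thetaTerm_add hk hi, thetaTerm_neg_add hk hi, tsum_mul_left]
  ring

theorem tripleProd_ne_zero {q : ℂ} (hq : ‖q‖ < 1) {k i : ℕ} (hk : 1 ≤ k) (hi : i ≤ k) :
    tripleProd k i q ≠ 0 := by
  have h : ∀ n : ℕ, n ≠ 0 → ‖q ^ n‖ < 1 := fun n hn => by
    rw [norm_pow]
    exact pow_lt_one₀ (norm_nonneg q) hq hn
  have hp := h (2 * k + 1) (by omega)
  exact mul_ne_zero (mul_ne_zero (qPochInf_ne_zero hp (h _ (by omega)))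
    (qPochInf_ne_zero hp (h _ (by omega)))) (qPochInf_ne_zero hp hp)

end TruncatedTheta

theorem theorem1p1 (k i ℓ : ℕ) (hk : 1 ≤ k) (hi : i ≤ k) (q : ℂ) (hq : ‖q‖ < 1) :
    Summable (TruncatedTheta.multisumTerm k i ℓ hk q) ∧
    1 / TruncatedTheta.tripleProd k i q *
        ∑ j ∈ Finset.Icc (-(ℓ : ℤ)) ((ℓ : ℤ) - 1),
          (-1 : ℂ) ^ j * q ^ TruncatedTheta.thetaExp k i j =
      1 + (-1 : ℂ) ^ ((ℓ : ℤ) - 1) * q ^ TruncatedTheta.prefExp k i ℓ *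
          TruncatedTheta.qPochInf q q / TruncatedTheta.tripleProd k i q *
        ∑' n : Fin k → ℕ, TruncatedTheta.multisumTerm k i ℓ hk q n := by
  have hT := TruncatedTheta.tripleProd_ne_zero hq hk hi
  have hP := TruncatedTheta.qPochInf_ne_zero hq hq
  have hsum := TruncatedTheta.tripleProd_eq_sum_add hq hk hi ℓ
  simp only [TruncatedTheta.thetaTerm] at hsum
  obtain ⟨k, rfl⟩ : ∃ m, k = m + 1 := ⟨k - 1, by omega⟩
  have hterm : TruncatedTheta.multisumTerm (k + 1) i ℓ hk q = TruncatedTheta.chainTerm q ℓ k i :=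
    funext fun n => TruncatedTheta.multisumTerm_eq_chainTerm k i ℓ hk q n
  rw [hterm]
  refine ⟨TruncatedTheta.summable_chainTerm hq ℓ k i, ?_⟩
  -- The factor (q)_∞ cancels against the limit of the chain, and (-1)^(ℓ-1) = -(-1)^ℓ moves the
  -- tail in `hsum` to the other side.
  rw [TruncatedTheta.tsum_chainTerm hq ℓ k i hi, zpow_sub_one₀ (by norm_num), zpow_natCast,
    inv_neg_one]
  field_simp
  linear_combination -hsum
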